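/- Let $p,q,r$ be distinct positive integers, let $n=p+q+r$, and let $\alpha,\beta,\gamma,y_0,\dots,y_{n-1}$ be independent indeterminates. The recurrence $$y_{k+n}=\frac{\alpha\, y_{k+p}\,y_{k+n-p}+\beta\, y_{k+q}\,y_{k+n-q}+\gamma\, y_{k+r}\,y_{k+n-r}}{y_k}\qquad(k\ge 0)$$ defines a unique sequence $(y_m)_{m\ge 0}$ of rational functions (no term is zero, so the division is always possible), and every term $y_m$ is a Laurent polynomial in $y_0,\dots,y_{n-1}$ with coefficients in $\mathbb{Z}[\alpha,\beta,\gamma]$, that is, $y_m\in\mathbb{Z}[\alpha,\beta,\gamma][y_0^{\pm1},\dots,y_{n-1}^{\pm1}]$. In particular, the Gale–Robinson integrality conjecture holds: if instead $\alpha,\beta,\gamma$ are positive integers and $y_0=\dots=y_{n-1}=1$, then every term of the rational sequence defined by the recurrence is a (nonzero) integer. This covers the Somos-6 sequence ($y_0=\dots=y_5=1$, $y_{k+6}y_k=y_{k+1}y_{k+5}+y_{k+2}y_{k+4}+y_{k+3}^2$) and the Somos-7 sequence ($y_0=\dots=y_6=1$, $y_{k+7}y_k=y_{k+1}y_{k+6}+y_{k+2}y_{k+5}+y_{k+3}y_{k+4}$):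 all their terms are (nonzero) integers. -/

import Mathlib

/-- The coefficient ring `ℤ[α, β, γ]`: integer polynomials in three indeterminates. -/
abbrev GRCoeff : Type := MvPolynomial (Fin 3) ℤ

/-- The field of rational functions in the initial terms `y₀, …, y_{n-1}`, taken as independent
variables over `ℤ[α, β, γ]`. -/
abbrev GRField (n : ℕ) : Type := FractionRing (MvPolynomial (Fin n) GRCoeff)

/-- A coefficient indeterminate, as a rational function: the indices `0, 1, 2` stand for
`α, β, γ`. -/
noncomputable def GRField.param (n : ℕ) (j : Fin 3) : GRField n :=
  algebraMap GRCoeff (GRField n) (MvPolynomial.X j)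

/-- The `i`-th initial variable, as a rational function. -/
noncomputable def GRField.var (n : ℕ) (i : Fin n) : GRField n :=
  algebraMap (MvPolynomial (Fin n) GRCoeff) (GRField n) (MvPolynomial.X i)

/-- The ring `ℤ[α, β, γ][y₀^{±1}, …, y_{n-1}^{±1}]` of Laurent polynomials in the initial
variables with coefficients in `ℤ[α, β, γ]`, inside the field of rational functions. -/
noncomputable def laurentRing (n : ℕ) : Subalgebra GRCoeff (GRField n) :=
  Algebra.adjoin GRCoeff
    (Set.range (GRField.var n) ∪ Set.range fun i => (GRField.var n i)⁻¹)

/-- The three-term Gale-Robinson recurrence with `n = p + q + r`. -/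
def IsGaleRobinson {F : Type*} [Field F] (p q r : ℕ) (α β γ : F) (y : ℕ → F) : Prop :=
  ∀ k : ℕ, y (k + (p + q + r)) =
    (α * y (k + p) * y (k + (p + q + r) - p)
      + β * y (k + q) * y (k + (p + q + r) - q)
      + γ * y (k + r) * y (k + (p + q + r) - r)) / y k

/-- `y` is the generic Gale-Robinson sequence: it satisfies the recurrence with indeterminate
coefficients `α, β, γ`, and its first `n` terms are the independent variables. -/
def IsGenericGaleRobinson (p q r : ℕ) (y : ℕ → GRField (p + q + r)) : Prop :=
  (∀ i : Fin (p + q + r), y i = GRField.var (p + q + r) i) ∧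
    IsGaleRobinson p q r (GRField.param (p + q + r) 0) (GRField.param (p + q + r) 1)
      (GRField.param (p + q + r) 2) y

/-!
A Gale-Robinson sequence `y` lifts to the solution `Y x = y (M + w ⬝ᵥ x)`, `w = (p, q, r)`, of the
cube recurrence `Y (x + 1) * Y x = ∑ t, c t * Y (x + 𝐞[t]) * Y (x + 1 - 𝐞[t])` on `ℤ³`, with
`𝐞[t]` the unit vectors, where the initial data are the values on a window of `n = p + q + r`
consecutive levels `w ⬝ᵥ x`. It suffices to treat independent initial variables, which specialize
to any nonzero initial values.

By induction a value of this generic solution is a Laurent polynomial in the values on the windows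
from levels `m + 1` and `m + n + 1` on. In terms of the variables on the window from level `m` on,
its denominator is therefore a product of values at level `m + n`, and also a product of values at
levels `m + n + 1, …, m + 2 * n`. The former values `Y (v + 1)` are prime, being linear in the
coefficients, so it remains to see that they do not divide the latter values `Y y`.

If `y t ≤ v t + 1` for some `t`, give the variable at `v + 𝐞[t]` a negative value that makes
`Y (v + 1)` vanish; all other values on that half space stay positive. The only other case is
`y = v + 1 + 1`. There the identity obtained by eliminating the edge centres of a `2 × 2 × 2` block
depends linearly on `Y v`, which is not determined by the other values modulo `Y (v + 1)`.
-/

open Finset MvPolynomial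

local notation "𝐞[" t "]" => (Pi.single t 1 : Fin 3 → ℤ)

/-! ### The cube recurrence -/

section Cube

variable {w : Fin 3 → ℤ} {m m' T T' : ℤ}

theorem weight_lt_sum (hw : ∀ t, 0 < w t) (t : Fin 3) : w t < ∑ s, w s := by
  have h := hw 0; have h' := hw 1; have h'' := hw 2
  rw [Fin.sum_univ_three]; fin_cases t <;> simp <;> linarith

theorem weight_add_lt_sum (hw : ∀ t, 0 < w t) {s t : Fin 3} (hst : s ≠ t) :
    w s + w t < ∑ u, w u := by
  have h := hw 0; have h' := hw 1; have h'' := hw 2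
  rw [Fin.sum_univ_three]; fin_cases s <;> fin_cases t <;> simp at hst ⊢ <;> linarith

/-- The lattice points whose level `w ⬝ᵥ x` is one of the `∑ t, w t` values from `m` on: initial
data for the cube recurrence. -/
def window (w : Fin 3 → ℤ) (m : ℤ) : Set (Fin 3 → ℤ) :=
  {x | m ≤ w ⬝ᵥ x ∧ w ⬝ᵥ x < m + ∑ t, w t}

/-- The cube recurrence with coefficients `c`, on the unit cubes of `ℤ³` whose lowest vertex `x` has
level `w ⬝ᵥ x` at least `m` and whose highest vertex `x + 1` has level at most `T`. -/
def CubeRec {R : Type*} [CommRing R] (w : Fin 3 → ℤ) (c : Fin 3 → R) (m T : ℤ)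
    (Y : (Fin 3 → ℤ) → R) : Prop :=
  ∀ x, m ≤ w ⬝ᵥ x → w ⬝ᵥ (x + 1) ≤ T →
    Y (x + 1) * Y x = ∑ t, c t * Y (x + 𝐞[t]) * Y (x + 1 - 𝐞[t])

theorem level_add_single (w x : Fin 3 → ℤ) (t : Fin 3) : w ⬝ᵥ (x + 𝐞[t]) = w ⬝ᵥ x + w t := by
  rw [dotProduct_add, dotProduct_single_one]

theorem level_sub_single (w x : Fin 3 → ℤ) (t : Fin 3) : w ⬝ᵥ (x - 𝐞[t]) = w ⬝ᵥ x - w t := by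
  rw [dotProduct_sub, dotProduct_single_one]

theorem level_add_one (w x : Fin 3 → ℤ) : w ⬝ᵥ (x + 1) = w ⬝ᵥ x + ∑ t, w t := by
  rw [dotProduct_add, dotProduct_one]

theorem level_sub_one (w x : Fin 3 → ℤ) : w ⬝ᵥ (x - 1) = w ⬝ᵥ x - ∑ t, w t := by
  rw [dotProduct_sub, dotProduct_one]

theorem add_one_sub_single_ne (v : Fin 3 → ℤ) (s t : Fin 3) : v + 1 - 𝐞[s] ≠ v + 𝐞[t] := fun h => by
  have := congrArg (1 ⬝ᵥ ·) h
  simp only [level_add_single, level_sub_single, level_add_one, Pi.one_apply,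
    Fin.sum_univ_three] at this
  lia

theorem add_one_sub_single_ne_self (v : Fin 3 → ℤ) (t : Fin 3) : v + 1 - 𝐞[t] ≠ v := fun h => by
  have := congrArg (1 ⬝ᵥ ·) h
  simp only [level_sub_single, level_add_one, Pi.one_apply, Fin.sum_univ_three] at this
  lia

theorem eq_of_le_of_level_le (hw : ∀ t, 0 < w t) {x y : Fin 3 → ℤ} (hxy : x ≤ y)
    (h : w ⬝ᵥ y ≤ w ⬝ᵥ x) : x = y := by
  by_contra hne
  obtain ⟨hle, t, ht⟩ := Pi.lt_def.1 (lt_of_le_of_ne hxy hne)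
  exact h.not_gt (sum_lt_sum (fun s _ => mul_le_mul_of_nonneg_left (hle s) (hw s).le)
    ⟨t, mem_univ t, mul_lt_mul_of_pos_left ht (hw t)⟩)

theorem cube_induction (hw : ∀ t, 0 < w t) {C : (Fin 3 → ℤ) → Prop}
    (init : ∀ x ∈ window w m, w ⬝ᵥ x ≤ T → C x)
    (step : ∀ x, m ≤ w ⬝ᵥ x → w ⬝ᵥ (x + 1) ≤ T → C x → (∀ t, C (x + 𝐞[t])) →
      (∀ t, C (x + 1 - 𝐞[t])) → C (x + 1)) :
    ∀ x, m ≤ w ⬝ᵥ x → w ⬝ᵥ x ≤ T → C x := by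
  suffices h : ∀ (k : ℕ) (x : Fin 3 → ℤ), m ≤ w ⬝ᵥ x → w ⬝ᵥ x ≤ T → w ⬝ᵥ x < m + k → C x from
    fun x hx hxT => h (w ⬝ᵥ x - m + 1).toNat x hx hxT (by lia)
  intro k
  induction k with
  | zero => intro x h _ h'; lia
  | succ k ih =>
    intro x hx hxT hxk
    by_cases hwin : w ⬝ᵥ x < m + ∑ t, w t
    · exact init x ⟨hx, hwin⟩ hxT
    obtain ⟨x, rfl⟩ : ∃ z, x = z + 1 := ⟨x - 1, by simp⟩
    have hpos := fun t => hw t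
    have hlt := weight_lt_sum hw
    rw [level_add_one] at *
    have low : ∀ z, w ⬝ᵥ x ≤ w ⬝ᵥ z → w ⬝ᵥ z < w ⬝ᵥ x + ∑ t, w t → C z := fun z h h' =>
      ih z (by lia) (by lia) (by lia)
    refine step x (by lia) (by rw [level_add_one]; lia) (low _ le_rfl (by linarith [hw 0, hlt 0]))
      (fun t => low _ ?_ ?_) fun t => low _ ?_ ?_
    all_goals
      simp only [level_add_single, level_sub_single, level_add_one]
      linarith [hw t, hlt t]

theorem exists_vertices_ne (hw : ∀ t, 0 < w t) {x v : Fin 3 → ℤ} {t : Fin 3} (hxt : x t ≤ v t) :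
    ∃ s, x + 𝐞[s] ≠ v + 1 ∧ x + 1 - 𝐞[s] ≠ v + 1 := by
  by_cases h : x + 𝐞[t] = v + 1
  · obtain ⟨s, hst⟩ := exists_ne t
    refine ⟨s, fun h' => ?_, fun h' => ?_⟩
    · simpa [hst] using congrFun (h'.trans h.symm) s
    · have h := congrArg (w ⬝ᵥ ·) h
      have h' := congrArg (w ⬝ᵥ ·) h'
      simp only [level_add_single, level_sub_single, level_add_one] at h h'
      linarith [weight_add_lt_sum hw hst]
  · exact ⟨t, h, fun h' => by have := congrFun h' t; simp at this; lia⟩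

namespace CubeRec

variable {R S : Type*} [CommRing R] [CommRing S] {c : Fin 3 → R} {Y Z : (Fin 3 → ℤ) → R}

theorem mono (h : CubeRec w c m T Y) (hm : m ≤ m') (hT : T' ≤ T) : CubeRec w c m' T' Y :=
  fun x hx hxT => h x (hm.trans hx) (hxT.trans hT)

theorem map (h : CubeRec w c m T Y) (φ : R →+* S) : CubeRec w (φ ∘ c) m T (φ ∘ Y) := by
  intro x hx hxT
  simpa only [map_mul, map_sum, Function.comp_apply] using congrArg φ (h x hx hxT)

theorem ext [IsDomain R] (hw : ∀ t, 0 < w t) (hY : CubeRec w c m T Y) (hZ : CubeRec w c m T Z)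
    (hne : ∀ x, m ≤ w ⬝ᵥ x → w ⬝ᵥ x < T → Y x ≠ 0)
    (heq : ∀ x ∈ window w m, w ⬝ᵥ x ≤ T → Y x = Z x) :
    ∀ x, m ≤ w ⬝ᵥ x → w ⬝ᵥ x ≤ T → Y x = Z x := by
  refine cube_induction hw heq fun x hx hxT h h₁ h₂ => ?_
  have hxT' : w ⬝ᵥ x < T := by
    rw [level_add_one] at hxT; linarith [hw 0, weight_lt_sum hw 0]
  refine mul_right_cancel₀ (hne x hx hxT') ?_
  rw [hY x hx hxT, h, hZ x hx hxT]
  exact sum_congr rfl fun t _ => by rw [h₁, h₂]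

theorem exists_extension (hw : ∀ t, 0 < w t) (hY : CubeRec w c m (T - 1) Y)
    (hdvd : ∀ x, m ≤ w ⬝ᵥ x → w ⬝ᵥ (x + 1) = T →
      Y x ∣ ∑ t, c t * Y (x + 𝐞[t]) * Y (x + 1 - 𝐞[t])) :
    ∃ Z, CubeRec w c m T Z ∧ ∀ x, w ⬝ᵥ x < T → Z x = Y x := by
  choose! q hq using hdvd
  let Z (x : Fin 3 → ℤ) : R := if w ⬝ᵥ x < T then Y x else q (x - 1)
  have hZ (x) (hx : w ⬝ᵥ x < T) : Z x = Y x := if_pos hx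
  refine ⟨Z, fun x hx hxT => ?_, hZ⟩
  have h₀ : w ⬝ᵥ x < w ⬝ᵥ (x + 1) := by
    rw [level_add_one]; linarith [hw 0, weight_lt_sum hw 0]
  have h₁ (t : Fin 3) : w ⬝ᵥ (x + 𝐞[t]) < w ⬝ᵥ (x + 1) := by
    rw [level_add_one, level_add_single]; linarith [weight_lt_sum hw t]
  have h₂ (t : Fin 3) : w ⬝ᵥ (x + 1 - 𝐞[t]) < w ⬝ᵥ (x + 1) := by
    rw [level_sub_single]; linarith [hw t]
  simp only [hZ _ (h₀.trans_le hxT), hZ _ ((h₁ _).trans_le hxT), hZ _ ((h₂ _).trans_le hxT)]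
  rcases hxT.eq_or_lt with h | h
  · rw [hq x hx h, mul_comm]
    simp [Z, h]
  · rw [hZ _ h, hY x hx (by linarith)]

section Ordered

variable [LinearOrder R] [IsStrictOrderedRing R]

theorem pos (hw : ∀ t, 0 < w t) (hY : CubeRec w c m T Y) (hc : ∀ t, 0 < c t)
    (hpos : ∀ x ∈ window w m, w ⬝ᵥ x ≤ T → 0 < Y x) : ∀ x, m ≤ w ⬝ᵥ x → w ⬝ᵥ x ≤ T → 0 < Y x := by
  refine cube_induction hw hpos fun x hx hxT h h₁ h₂ => ?_
  have hsum : 0 < Y (x + 1) * Y x := by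
    rw [hY x hx hxT]
    exact sum_pos (fun t _ => mul_pos (mul_pos (hc t) (h₁ t)) (h₂ t)) univ_nonempty
  exact (pos_iff_pos_of_mul_pos hsum).2 h

/-- On the half space `x t ≤ v t + 1` the value at `v + 𝐞[t]`, whose sign is not prescribed, enters
only into the unit cube with lowest vertex `v`. -/
theorem pos_of_le (hw : ∀ t, 0 < w t) (hY : CubeRec w c m T Y) (hc : ∀ t, 0 < c t)
    {v : Fin 3 → ℤ} (hv : w ⬝ᵥ v = m) (hzero : Y (v + 1) = 0) (t : Fin 3)
    (hpos : ∀ x ∈ window w m, x ≠ v + 𝐞[t] → 0 < Y x) (x : Fin 3 → ℤ) (hx : m ≤ w ⬝ᵥ x)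
    (hxT : w ⬝ᵥ x ≤ T) (hxt : x t ≤ v t + 1) (hxv : x ≠ v + 𝐞[t]) (hxv' : x ≠ v + 1) : 0 < Y x := by
  suffices h : x t ≤ v t + 1 → x ≠ v + 𝐞[t] → 0 ≤ Y x ∧ (x ≠ v + 1 → 0 < Y x) from
    (h hxt hxv).2 hxv'
  clear hxt hxv hxv'
  revert x
  refine cube_induction hw (fun x hx _ _ hne => ⟨(hpos x hx hne).le, fun _ => hpos x hx hne⟩)
    fun x hx hxT h h₁ h₂ hxt _ => ?_
  have hxt : x t ≤ v t := by simpa using hxt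
  rcases eq_or_ne x v with rfl | hxv
  · exact ⟨hzero.ge, fun h => absurd rfl h⟩
  have ne_of_apply {y z : Fin 3 → ℤ} (h : y t < z t) : y ≠ z := fun e => h.ne (congrFun e t)
  have hYx : 0 < Y x :=
    (h (by linarith) (ne_of_apply (by simp; lia))).2 (ne_of_apply (by simp; lia))
  have low (s : Fin 3) : 0 ≤ Y (x + 𝐞[s]) ∧ (x + 𝐞[s] ≠ v + 1 → 0 < Y (x + 𝐞[s])) := by
    refine h₁ s ?_ ?_
    · rcases eq_or_ne s t with rfl | hst
      · simpa using hxt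
      · simp [hst.symm]; linarith
    · rcases eq_or_ne s t with rfl | hst
      · simpa using hxv
      · exact ne_of_apply (by simp [hst.symm]; lia)
  have high (s : Fin 3) :
      0 ≤ Y (x + 1 - 𝐞[s]) ∧ (x + 1 - 𝐞[s] ≠ v + 1 → 0 < Y (x + 1 - 𝐞[s])) := by
    rcases eq_or_ne s t with rfl | hst
    · exact h₂ s (by simp; linarith) (ne_of_apply (by simp; lia))
    · refine h₂ s (by simp [hst.symm]; linarith) fun e => ?_
      have := congrArg (w ⬝ᵥ ·) e
      simp only [level_add_single, level_sub_single, level_add_one] at this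
      linarith [weight_add_lt_sum hw hst]
  have hsum : 0 < Y (x + 1) * Y x := by
    rw [hY x hx hxT]
    obtain ⟨s, hs, hs'⟩ := exists_vertices_ne hw hxt
    exact sum_pos' (fun s _ => mul_nonneg (mul_nonneg (hc s).le (low s).1) (high s).1)
      ⟨s, mem_univ s, mul_pos (mul_pos (hc s) ((low s).2 hs)) ((high s).2 hs')⟩
  have := (pos_iff_pos_of_mul_pos hsum).2 hYx
  exact ⟨this.le, fun _ => this⟩

end Ordered

end CubeRec

end Cube

/-! ### Blocks of eight unit cubes -/

section Block

variable {w : Fin 3 → ℤ} {m T : ℤ} {R S : Type*} [CommRing R] [CommRing S] {c : Fin 3 → R}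
  {Y Z : (Fin 3 → ℤ) → R}

/-- In a `2 × 2 × 2` block of unit cubes with lowest vertex `x` and centre `x + 1`, eliminating the
twelve centres of edges expresses the highest vertex `x + 1 + 1` as `blockNum c Y x` divided by the
product of the three values `Y (x + 1 - 𝐞[t])`. -/
def blockNum (c : Fin 3 → R) (Y : (Fin 3 → ℤ) → R) (x : Fin 3 → ℤ) : R :=
  (∏ t, Y (x + 1 + 𝐞[t])) * Y x +
    ∑ t, c t ^ 2 *
      ((∏ s ∈ univ.erase t, Y (x + 1 - 𝐞[s])) * Y (x + 1 + 𝐞[t]) * Y (x + 1 + 1 - 𝐞[t] - 𝐞[t]) -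
        Y (x + 1 - 𝐞[t]) * (∏ s ∈ univ.erase t, Y (x + 1 + 𝐞[s])) * Y (x + 𝐞[t] + 𝐞[t]))

theorem map_blockNum (φ : R →+* S) (c : Fin 3 → R) (Y : (Fin 3 → ℤ) → R) (x : Fin 3 → ℤ) :
    φ (blockNum c Y x) = blockNum (φ ∘ c) (φ ∘ Y) x := by
  simp only [blockNum, map_add, map_mul, map_sub, map_sum, map_prod, map_pow, Function.comp_apply]

theorem CubeRec.prod_mul_sum_eq (hw : ∀ t, 0 < w t) (hY : CubeRec w c m T Y) {x : Fin 3 → ℤ}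
    (hx : m ≤ w ⬝ᵥ x) (hxT : w ⬝ᵥ (x + 1 + 1) ≤ T + 1) :
    (∏ t, Y (x + 1 - 𝐞[t])) * ∑ t, c t * Y (x + 1 + 𝐞[t]) * Y (x + 1 + 1 - 𝐞[t]) =
      Y (x + 1) * blockNum c Y x := by
  have low := hY x hx (by rw [level_add_one] at hxT; linarith [hw 0, weight_lt_sum hw 0])
  have mid (t : Fin 3) := hY (x + 𝐞[t]) (by rw [level_add_single]; linarith [hw t])
    (by simp only [level_add_single, level_add_one] at *; linarith [hw t, weight_lt_sum hw t])
  have high (t : Fin 3) := hY (x + 1 - 𝐞[t])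
    (by simp only [level_sub_single, level_add_one]; linarith [hw t, weight_lt_sum hw t])
    (by simp only [level_sub_single, level_add_one] at *; linarith [hw t])
  let p (t : Fin 3) : R := c t * Y (x + 1 + 𝐞[t]) * ∏ s ∈ univ.erase t, Y (x + 1 - 𝐞[s])
  let q (t : Fin 3) : R := c t * Y (x + 1 - 𝐞[t]) * ∏ s ∈ univ.erase t, Y (x + 1 + 𝐞[s])
  have one_eq : (1 : Fin 3 → ℤ) = 𝐞[0] + 𝐞[1] + 𝐞[2] := by ext i; fin_cases i <;> simp
  have erase : (univ : Finset (Fin 3)).erase 0 = {1, 2} ∧ (univ : Finset (Fin 3)).erase 1 = {0, 2} ∧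
      (univ : Finset (Fin 3)).erase 2 = {0, 1} := ⟨rfl, rfl, rfl⟩
  linear_combination (norm := skip) p 0 * high 0 + p 1 * high 1 + p 2 * high 2
    - (∏ t, Y (x + 1 + 𝐞[t])) * low - (q 0 * mid 0 + q 1 * mid 1 + q 2 * mid 2)
  simp only [p, q, blockNum, Fin.sum_univ_three, Fin.prod_univ_three, erase, prod_pair, one_eq,
    ne_eq, Fin.reduceEq, not_false_eq_true]
  abel_nf
  ring

theorem CubeRec.prod_mul_eq_blockNum [IsDomain R] (hw : ∀ t, 0 < w t) (hY : CubeRec w c m T Y)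
    {x : Fin 3 → ℤ} (hx : m ≤ w ⬝ᵥ x) (hxT : w ⬝ᵥ (x + 1 + 1) ≤ T) (hne : Y (x + 1) ≠ 0) :
    (∏ t, Y (x + 1 - 𝐞[t])) * Y (x + 1 + 1) = blockNum c Y x := by
  refine mul_left_cancel₀ hne ?_
  rw [← hY.prod_mul_sum_eq hw hx (by linarith), ← hY (x + 1) ?_ hxT]
  · ring
  · rw [level_add_one]; linarith [hw 0, weight_lt_sum hw 0]

theorem CubeRec.eq_of_eq_zero [IsDomain R] (hw : ∀ t, 0 < w t) (hY : CubeRec w c m T Y)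
    (hZ : CubeRec w c m T Z) {v : Fin 3 → ℤ} (hv : w ⬝ᵥ v = m) (hYv : Y (v + 1) = 0)
    (hZv : Z (v + 1) = 0) (hne : ∀ x ∈ window w m, Y x ≠ 0)
    (heq : ∀ x ∈ window w m, x ≠ v → Y x = Z x) (x : Fin 3 → ℤ) (hxv : x ≠ v) (hx : m ≤ w ⬝ᵥ x)
    (hxm : w ⬝ᵥ x < m + ∑ t, w t + ∑ t, w t) (hxT : w ⬝ᵥ x ≤ T) : Y x = Z x := by
  suffices h : x ≠ v → w ⬝ᵥ x < m + ∑ t, w t + ∑ t, w t → Y x = Z x from h hxv hxm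
  clear hxv hxm
  revert x
  refine cube_induction hw (fun x hx _ hxv _ => heq x hx hxv) fun x hx hxT h h₁ h₂ _ hxm => ?_
  rcases eq_or_ne x v with rfl | hxv
  · rw [hYv, hZv]
  rw [level_add_one] at hxm
  have hlt := weight_lt_sum hw
  have ne_of_level {z : Fin 3 → ℤ} (h : m < w ⬝ᵥ z) : z ≠ v := fun e => h.ne' (by rw [e, hv])
  replace h₁ (t : Fin 3) : Y (x + 𝐞[t]) = Z (x + 𝐞[t]) := by
    refine h₁ t (ne_of_level ?_) ?_ <;> rw [level_add_single] <;> linarith [hw t, hlt t]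
  replace h₂ (t : Fin 3) : Y (x + 1 - 𝐞[t]) = Z (x + 1 - 𝐞[t]) := by
    refine h₂ t (ne_of_level ?_) ?_ <;> rw [level_sub_single, level_add_one] <;>
      linarith [hw t, hlt t]
  refine mul_right_cancel₀ (hne x ⟨hx, by linarith⟩) ?_
  rw [hY x hx hxT, h hxv (by linarith [hw 0, hlt 0]), hZ x hx hxT]
  exact sum_congr rfl fun t _ => by rw [h₁, h₂]

theorem blockNum_sub_blockNum (hw : ∀ t, 0 < w t) {x : Fin 3 → ℤ}
    (h : ∀ z, w ⬝ᵥ x < w ⬝ᵥ z → w ⬝ᵥ z < w ⬝ᵥ (x + 1 + 1) → Y z = Z z) :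
    blockNum c Y x - blockNum c Z x = (∏ t, Y (x + 1 + 𝐞[t])) * (Y x - Z x) := by
  have hlt := weight_lt_sum hw
  have h₁ (t : Fin 3) : Y (x + 1 + 𝐞[t]) = Z (x + 1 + 𝐞[t]) := by
    apply h <;> simp only [level_add_single, level_add_one] <;> linarith [hw t, hlt t]
  have h₂ (t : Fin 3) : Y (x + 1 - 𝐞[t]) = Z (x + 1 - 𝐞[t]) := by
    apply h <;> simp only [level_sub_single, level_add_one] <;> linarith [hw t, hlt t]
  have h₃ (t : Fin 3) : Y (x + 𝐞[t] + 𝐞[t]) = Z (x + 𝐞[t] + 𝐞[t]) := by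
    apply h <;> simp only [level_add_single, level_add_one] <;> linarith [hw t, hlt t]
  have h₄ (t : Fin 3) : Y (x + 1 + 1 - 𝐞[t] - 𝐞[t]) = Z (x + 1 + 1 - 𝐞[t] - 𝐞[t]) := by
    apply h <;> simp only [level_sub_single, level_add_one] <;> linarith [hw t, hlt t]
  simp only [blockNum, h₁, h₂, h₃, h₄]
  ring

end Block

/-! ### Generic initial data -/

section Retraction

variable {A : Type*} [CommRing A] {φ : A →+* A} {e : A}

theorem dvd_iff_map_eq_zero (he : φ e = 0) (hφ : ∀ z, e ∣ z - φ z) (z : A) :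
    e ∣ z ↔ φ z = 0 := by
  refine ⟨fun ⟨y, hy⟩ => by rw [hy, map_mul, he, zero_mul], fun h => ?_⟩
  simpa only [h, sub_zero] using hφ z

theorem prime_of_map_eq_zero [IsDomain A] (hne : e ≠ 0) (he : φ e = 0) (hφ : ∀ z, e ∣ z - φ z) :
    Prime e := by
  have ker_eq : Ideal.span {e} = RingHom.ker φ :=
    Ideal.ext fun z => Ideal.mem_span_singleton.trans (dvd_iff_map_eq_zero he hφ z)
  rw [← Ideal.span_singleton_prime hne, ker_eq]
  exact RingHom.ker_isPrime φ

end Retraction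

/-- The monomials in the lattice variables of `ℤ[α, β, γ][Y_x : x ∈ ℤ³]`. -/
noncomputable def latticeMonomials : Submonoid (MvPolynomial (Fin 3 ⊕ (Fin 3 → ℤ)) ℤ) :=
  Submonoid.closure (Set.range fun x => X (Sum.inr x))

/-- The ring `ℤ[α, β, γ][Y_x^{±1} : x ∈ ℤ³]` of generic initial data for the cube recurrence. -/
abbrev LatticeLaurent : Type := Localization latticeMonomials

namespace LatticeLaurent

/-- The coefficient indeterminates `α, β, γ`. -/
noncomputable def param (t : Fin 3) : LatticeLaurent :=
  algebraMap (MvPolynomial (Fin 3 ⊕ (Fin 3 → ℤ)) ℤ) _ (X (Sum.inl t))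

/-- The lattice variables `Y_x`. -/
noncomputable def var (x : Fin 3 → ℤ) : LatticeLaurentˣ :=
  (IsLocalization.map_units LatticeLaurent (M := latticeMonomials)
    ⟨X (Sum.inr x), Submonoid.subset_closure ⟨x, rfl⟩⟩).unit

theorem val_var (x : Fin 3 → ℤ) : (var x : LatticeLaurent) =
    algebraMap (MvPolynomial (Fin 3 ⊕ (Fin 3 → ℤ)) ℤ) _ (X (Sum.inr x)) := rfl

instance : IsDomain LatticeLaurent := by
  refine IsLocalization.isDomain_localization (Submonoid.closure_le.2 ?_)
  rintro _ ⟨x, rfl⟩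
  exact mem_nonZeroDivisors_of_ne_zero (X_ne_zero _)

theorem hom_ext {S : Type*} [CommRing S] {φ ψ : LatticeLaurent →+* S}
    (hc : ∀ t, φ (param t) = ψ (param t)) (hv : ∀ x, φ (var x) = ψ (var x)) : φ = ψ := by
  refine IsLocalization.ringHom_ext latticeMonomials
    (MvPolynomial.ringHom_ext (fun n => ?_) (Sum.rec hc hv))
  simp only [eq_intCast, map_intCast]

section Lift

variable {S : Type*} [CommRing S] (c : Fin 3 → S) (f : (Fin 3 → ℤ) → Sˣ)

/-- The ring homomorphism with prescribed values at the indeterminates. -/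
noncomputable def lift : LatticeLaurent →+* S :=
  IsLocalization.lift (M := latticeMonomials)
    (g := eval₂Hom (Int.castRingHom S) (Sum.elim c fun x => (f x : S))) <| by
      suffices h : latticeMonomials ≤ (IsUnit.submonoid S).comap
          (eval₂Hom (Int.castRingHom S) (Sum.elim c fun x => (f x : S))) from
        fun y => (IsUnit.mem_submonoid_iff _).1 (h y.2)
      rw [latticeMonomials, Submonoid.closure_le]
      rintro _ ⟨x, rfl⟩
      simp [IsUnit.mem_submonoid_iff]

@[simp]
theorem lift_param (t : Fin 3) : lift c f (param t) = c t := by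
  simp [lift, param]

@[simp]
theorem lift_var (x : Fin 3 → ℤ) : lift c f (var x) = f x := by
  simp [lift, val_var]

end Lift

instance : CharZero LatticeLaurent := (lift (1 : Fin 3 → ℚ) 1).charZero

theorem lift_mem {K : Type*} [Field K] (R : Subring K) {c : Fin 3 → K} {f : (Fin 3 → ℤ) → Kˣ}
    (hc : ∀ t, c t ∈ R) (hf : ∀ x, (f x : K) ∈ R) (hf' : ∀ x, (f x : K)⁻¹ ∈ R)
    (z : LatticeLaurent) : lift c f z ∈ R := by
  let g (x : Fin 3 → ℤ) : Rˣ := ⟨⟨f x, hf x⟩, ⟨(f x : K)⁻¹, hf' x⟩, by ext; simp, by ext; simp⟩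
  have h : lift c f = R.subtype.comp (lift (fun t => ⟨c t, hc t⟩) g) := by
    apply hom_ext <;> intro x <;> simp [g]
  rw [h]
  exact (lift (fun t => (⟨c t, hc t⟩ : R)) g z).2

/-- The numerator of the value at `v + 1` in the unit cube with lowest vertex `v`. -/
noncomputable def exchange (v : Fin 3 → ℤ) : LatticeLaurent :=
  ∑ t, param t * var (v + 𝐞[t]) * var (v + 1 - 𝐞[t])

/-- The value of the first coefficient at which `exchange v` vanishes. -/
noncomputable def root (v : Fin 3 → ℤ) : LatticeLaurent :=
  -(∑ t ∈ univ.erase 0, param t * var (v + 𝐞[t]) * var (v + 1 - 𝐞[t])) *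
    ↑(var (v + 𝐞[0]) * var (v + 1 - 𝐞[0]))⁻¹

/-- The endomorphism substituting `root v` for the first coefficient. -/
noncomputable def solve (v : Fin 3 → ℤ) : LatticeLaurent →+* LatticeLaurent :=
  lift (Function.update param 0 (root v)) var

theorem exchange_eq (v : Fin 3 → ℤ) :
    exchange v = (param 0 - root v) * ↑(var (v + 𝐞[0]) * var (v + 1 - 𝐞[0])) := by
  rw [sub_mul, root, Units.inv_mul_cancel_right, exchange, ← add_sum_erase univ _ (mem_univ 0)]
  push_cast
  ring

theorem solve_exchange (v : Fin 3 → ℤ) : solve v (exchange v) = 0 := by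
  have fixed : ∀ t ∈ univ.erase 0, solve v (param t * var (v + 𝐞[t]) * var (v + 1 - 𝐞[t])) =
      param t * var (v + 𝐞[t]) * var (v + 1 - 𝐞[t]) := fun t ht => by
    simp [solve, ne_of_mem_erase ht]
  rw [exchange, map_sum, ← add_sum_erase univ _ (mem_univ 0), sum_congr rfl fixed]
  simp [solve, root, mul_assoc]

theorem exchange_dvd_sub (v : Fin 3 → ℤ) (z : LatticeLaurent) : exchange v ∣ z - solve v z := by
  have h : Ideal.Quotient.mk (Ideal.span {exchange v}) =
      (Ideal.Quotient.mk (Ideal.span {exchange v})).comp (solve v) := by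
    refine hom_ext (S := LatticeLaurent ⧸ Ideal.span {exchange v}) (fun t => ?_) fun x => ?_
    · rcases eq_or_ne t 0 with rfl | ht
      · rw [RingHom.comp_apply, solve, lift_param, Function.update_self, Ideal.Quotient.eq,
          Ideal.mem_span_singleton, exchange_eq, Units.mul_right_dvd]
      · rw [RingHom.comp_apply, solve, lift_param, Function.update_of_ne ht]
    · rw [RingHom.comp_apply, solve, lift_var]
  exact Ideal.mem_span_singleton.1 (Ideal.Quotient.eq.1 (RingHom.congr_fun h z))

theorem exchange_ne_zero (v : Fin 3 → ℤ) : exchange v ≠ 0 := fun h => by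
  simpa [exchange] using congrArg (lift (1 : Fin 3 → ℚ) 1) h

theorem exchange_dvd_iff {v : Fin 3 → ℤ} {z : LatticeLaurent} : exchange v ∣ z ↔ solve v z = 0 :=
  dvd_iff_map_eq_zero (solve_exchange v) (exchange_dvd_sub v) z

theorem prime_exchange (v : Fin 3 → ℤ) : Prime (exchange v) :=
  prime_of_map_eq_zero (exchange_ne_zero v) (solve_exchange v) (exchange_dvd_sub v)

end LatticeLaurent

open LatticeLaurent

/-- `Y` solves the cube recurrence up to level `T`, with indeterminate coefficients and, on
`window w m`, with the independent variables as values. -/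
structure IsGeneric (w : Fin 3 → ℤ) (m T : ℤ) (Y : (Fin 3 → ℤ) → LatticeLaurent) : Prop where
  cubeRec : CubeRec w param m T Y
  eq_var : ∀ x ∈ window w m, Y x = var x

namespace IsGeneric

variable {w : Fin 3 → ℤ} {m T : ℤ} {Y : (Fin 3 → ℤ) → LatticeLaurent} {v : Fin 3 → ℤ}

theorem associated_exchange (hY : IsGeneric w m T Y) (hw : ∀ t, 0 < w t) (hv : w ⬝ᵥ v = m)
    (hT : m + ∑ t, w t ≤ T) : Associated (Y (v + 1)) (exchange v) := by
  have hlt := weight_lt_sum hw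
  have h := hY.cubeRec v hv.ge (by rwa [level_add_one, hv])
  have hvm : v ∈ window w m := ⟨hv.ge, by linarith [hw 0, hlt 0]⟩
  refine ⟨var v, ?_⟩
  rw [← hY.eq_var v hvm, h]
  refine sum_congr rfl fun t _ => ?_
  rw [hY.eq_var, hY.eq_var] <;> constructor <;>
    simp only [level_add_single, level_sub_single, level_add_one, hv] <;> linarith [hw t, hlt t]

theorem prime (hY : IsGeneric w m T Y) (hw : ∀ t, 0 < w t) (hv : w ⬝ᵥ v = m)
    (hT : m + ∑ t, w t ≤ T) : Prime (Y (v + 1)) :=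
  (hY.associated_exchange hw hv hT).prime_iff.2 (prime_exchange v)

theorem dvd_iff (hY : IsGeneric w m T Y) (hw : ∀ t, 0 < w t) (hv : w ⬝ᵥ v = m)
    (hT : m + ∑ t, w t ≤ T) {z : LatticeLaurent} : Y (v + 1) ∣ z ↔ solve v z = 0 :=
  (hY.associated_exchange hw hv hT).dvd_iff_dvd_left.trans exchange_dvd_iff

end IsGeneric

namespace LatticeLaurent

/-- The substitution of `-2` for the variable at `v + 𝐞[t]` and of `1` for all other indeterminates,
which annihilates `exchange v`. -/
noncomputable def evalNeg (v : Fin 3 → ℤ) (t : Fin 3) : LatticeLaurent →+* ℚ :=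
  lift 1 (Function.update 1 (v + 𝐞[t]) (Units.mk0 (-2) (by norm_num)))

theorem evalNeg_var_of_ne {v x : Fin 3 → ℤ} {t : Fin 3} (h : x ≠ v + 𝐞[t]) :
    evalNeg v t (var x) = 1 := by
  simp [evalNeg, h]

theorem evalNeg_exchange (v : Fin 3 → ℤ) (t : Fin 3) : evalNeg v t (exchange v) = 0 := by
  have term (s : Fin 3) : evalNeg v t (param s * var (v + 𝐞[s]) * var (v + 1 - 𝐞[s])) =
      1 - if s = t then 3 else 0 := by
    rw [map_mul, evalNeg_var_of_ne (add_one_sub_single_ne v s t)]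
    split_ifs with h
    · norm_num [evalNeg, h]
    · have hne : v + 𝐞[s] ≠ v + 𝐞[t] := fun h' => by simpa [h] using congrFun h' s
      rw [map_mul, evalNeg_var_of_ne hne]
      simp [evalNeg]
  rw [exchange, map_sum, sum_congr rfl fun s _ => term s]
  simp

/-- The endomorphism changing the sign of the variable at `v`. -/
noncomputable def negVar (v : Fin 3 → ℤ) : LatticeLaurent →+* LatticeLaurent :=
  lift param (Function.update var v (-var v))

theorem negVar_var_of_ne {v x : Fin 3 → ℤ} (h : x ≠ v) : negVar v (var x) = var x := by
  simp [negVar, h]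

theorem negVar_exchange (v : Fin 3 → ℤ) : negVar v (exchange v) = exchange v := by
  simp only [exchange, map_sum, map_mul]
  refine sum_congr rfl fun t _ => ?_
  rw [negVar_var_of_ne (by simp), negVar_var_of_ne (add_one_sub_single_ne_self v t), negVar,
    lift_param]

end LatticeLaurent

namespace IsGeneric

variable {w : Fin 3 → ℤ} {m T : ℤ} {Y : (Fin 3 → ℤ) → LatticeLaurent} {v : Fin 3 → ℤ}

theorem not_dvd_of_le (hY : IsGeneric w m T Y) (hw : ∀ t, 0 < w t) (hv : w ⬝ᵥ v = m)
    {t : Fin 3} {y : Fin 3 → ℤ} (hy : m + ∑ t, w t < w ⬝ᵥ y) (hyT : w ⬝ᵥ y ≤ T)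
    (hyt : y t ≤ v t + 1) : ¬Y (v + 1) ∣ Y y := by
  have hass := hY.associated_exchange hw hv (hy.le.trans hyT)
  have hzero {z : LatticeLaurent} (h : Y (v + 1) ∣ z) : evalNeg v t z = 0 := by
    have := map_dvd (evalNeg v t) (hass.symm.dvd.trans h)
    rwa [evalNeg_exchange, zero_dvd_iff] at this
  have hlt := weight_lt_sum hw t
  refine fun h => ((hY.cubeRec.map (evalNeg v t)).pos_of_le hw (fun s => by simp [evalNeg]) hv
    (hzero dvd_rfl) t (fun x hx hxv => ?_) y (by linarith [hw t]) hyT hyt ?_ ?_).ne' (hzero h)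
  · rw [Function.comp_apply, hY.eq_var x hx, evalNeg_var_of_ne hxv]
    exact one_pos
  · rintro rfl
    rw [level_add_single] at hy
    linarith
  · rintro rfl
    rw [level_add_one] at hy
    linarith

theorem not_dvd_add_one_add_one (hY : IsGeneric w m T Y) (hw : ∀ t, 0 < w t) (hv : w ⬝ᵥ v = m)
    (hT : w ⬝ᵥ (v + 1 + 1) ≤ T) : ¬Y (v + 1) ∣ Y (v + 1 + 1) := by
  intro hdvd
  have hlt := weight_lt_sum hw
  have hN : 0 < ∑ t, w t := (hw 0).trans (hlt 0)
  have hT' : m + ∑ t, w t ≤ T := by simp only [level_add_one, hv] at hT; linarith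
  have hsolve {z : LatticeLaurent} := hY.dvd_iff hw hv hT' (z := z)
  let ψ := (solve v).comp (negVar v)
  have hψ {z : LatticeLaurent} (h : Y (v + 1) ∣ z) : ψ z = 0 := by
    rw [RingHom.comp_apply, ← exchange_dvd_iff, ← negVar_exchange]
    exact map_dvd _ ((hY.associated_exchange hw hv hT').symm.dvd.trans h)
  have hc : solve v ∘ param = ψ ∘ param := by ext t; simp [ψ, negVar]
  have hφvar (x : Fin 3 → ℤ) : solve v (var x) = var x := by simp [solve]
  have hψvar (x : Fin 3 → ℤ) (h : x ≠ v) : ψ (var x) = var x := by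
    rw [RingHom.comp_apply, negVar_var_of_ne h, hφvar]
  -- The two substitutions differ at `v`; as both annihilate `Y (v + 1)`, the difference is not seen
  -- elsewhere below the level of `v + 1 + 1`.
  have hagree := (hY.cubeRec.map (solve v)).eq_of_eq_zero hw (hc ▸ hY.cubeRec.map ψ) hv
    (hsolve.1 dvd_rfl) (hψ dvd_rfl)
    (fun x hx => by simp [hY.eq_var x hx, hφvar])
    (fun x hx h => by simp [hY.eq_var x hx, hφvar, hψvar x h])
  have hblock := hY.cubeRec.prod_mul_eq_blockNum hw hv.ge hT (hY.prime hw hv hT').ne_zero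
  have hdiff := blockNum_sub_blockNum (c := solve v ∘ param) (Y := solve v ∘ Y) (Z := ψ ∘ Y)
    hw (x := v) fun z h h' => hagree z (by rintro rfl; exact h.false) (hv.symm.le.trans h.le)
      (by simpa only [level_add_one, hv] using h') (h'.le.trans hT)
  rw [← map_blockNum, hc, ← map_blockNum, ← hblock, hsolve.1 (hdvd.mul_left _),
    hψ (hdvd.mul_left _), sub_zero, eq_comm, mul_eq_zero, prod_eq_zero_iff] at hdiff
  rcases hdiff with ⟨t, -, ht⟩ | h
  · obtain ⟨s, hs⟩ := exists_ne t
    refine hY.not_dvd_of_le hw hv (t := s) (y := v + 1 + 𝐞[t]) ?_ ?_ ?_ (hsolve.2 ht)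
    · simp only [level_add_single, level_add_one]; linarith [hw t]
    · simp only [level_add_single, level_add_one] at *; linarith [hw t, hlt t]
    · simp [hs]
  · simp [hY.eq_var v ⟨hv.ge, by linarith⟩, hφvar, ψ, negVar] at h

theorem not_dvd (hY : IsGeneric w m T Y) (hw : ∀ t, 0 < w t) (hv : w ⬝ᵥ v = m) {y : Fin 3 → ℤ}
    (hy : m + ∑ t, w t < w ⬝ᵥ y) (hy' : w ⬝ᵥ y ≤ m + ∑ t, w t + ∑ t, w t) (hyT : w ⬝ᵥ y ≤ T) :
    ¬Y (v + 1) ∣ Y y := by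
  by_cases hle : ∃ t, y t ≤ v t + 1
  · obtain ⟨t, ht⟩ := hle
    exact hY.not_dvd_of_le hw hv hy hyT ht
  push Not at hle
  obtain rfl : v + 1 + 1 = y := eq_of_le_of_level_le hw (fun t => hle t)
    (by simpa only [level_add_one, hv] using hy')
  exact hY.not_dvd_add_one_add_one hw hv hyT

end IsGeneric

/-! ### The Laurent phenomenon for the cube recurrence -/

section Denominators

variable {L K : Type*} [CommRing L] [Field K] [Algebra L K]

theorem exists_mul_mem_range_of_mem_closure (D : Submonoid L) {G : Set K}
    (hG : ∀ g ∈ G, ∃ d ∈ D, algebraMap L K d * g ∈ (algebraMap L K).range) {z : K}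
    (hz : z ∈ Subring.closure G) : ∃ d ∈ D, algebraMap L K d * z ∈ (algebraMap L K).range := by
  induction hz using Subring.closure_induction with
  | mem x hx => exact hG x hx
  | zero => exact ⟨1, D.one_mem, by simp [zero_mem]⟩
  | one => exact ⟨1, D.one_mem, by simp [one_mem]⟩
  | add x y _ _ hx hy =>
    obtain ⟨d, hd, a, ha⟩ := hx
    obtain ⟨e, he, b, hb⟩ := hy
    refine ⟨d * e, D.mul_mem hd he, e * a + d * b, ?_⟩
    simp only [map_add, map_mul, ha, hb]
    ring
  | neg x _ hx =>
    obtain ⟨d, hd, a, ha⟩ := hx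
    exact ⟨d, hd, -a, by rw [map_neg, ha, mul_neg]⟩
  | mul x y _ _ hx hy =>
    obtain ⟨d, hd, a, ha⟩ := hx
    obtain ⟨e, he, b, hb⟩ := hy
    exact ⟨d * e, D.mul_mem hd he, a * b, by rw [map_mul, map_mul, ha, hb, mul_mul_mul_comm]⟩

theorem mem_range_of_coprime_denominators [FaithfulSMul L K] {P E : Set L}
    (hP : ∀ π ∈ P, Prime π) (hPE : ∀ π ∈ P, ∀ e ∈ E, ¬π ∣ e) {d e : L}
    (hd : d ∈ Submonoid.closure P) (he : e ∈ Submonoid.closure E) {z : K}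
    (hdz : algebraMap L K d * z ∈ (algebraMap L K).range)
    (hez : algebraMap L K e * z ∈ (algebraMap L K).range) : z ∈ (algebraMap L K).range := by
  have inj := FaithfulSMul.algebraMap_injective L K
  have hne (π) (hπ : π ∈ P) : ¬π ∣ e := by
    clear hez
    induction he using Submonoid.closure_induction with
    | mem x hx => exact hPE π hπ x hx
    | one => exact (hP π hπ).not_dvd_one
    | mul x y _ _ hx hy => exact fun h => ((hP π hπ).dvd_or_dvd h).elim hx hy
  induction hd using Submonoid.closure_induction generalizing z with
  | mem π hπ =>
    obtain ⟨s, hs⟩ := hdz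
    obtain ⟨t, ht⟩ := hez
    have h : e * s = π * t := inj (by rw [map_mul, map_mul, hs, ht, mul_left_comm])
    obtain ⟨u, rfl⟩ := ((hP π hπ).dvd_or_dvd (Dvd.intro t h.symm)).resolve_left (hne π hπ)
    refine ⟨u, mul_left_cancel₀ ((map_ne_zero_iff _ inj).2 (hP π hπ).ne_zero) ?_⟩
    rw [← hs, map_mul]
  | one => simpa using hdz
  | mul x y _ _ hx hy =>
    refine hy (hx ?_ ?_) hez
    · rwa [map_mul, mul_assoc] at hdz
    · rw [mul_left_comm]
      exact mul_mem (RingHom.mem_range_self _ _) hez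

end Denominators

section WindowRing

variable {w : Fin 3 → ℤ} {m T : ℤ} {K : Type*} [Field K] {c : Fin 3 → K} {Y Z : (Fin 3 → ℤ) → K}

/-- The ring of Laurent polynomials in the values of `Y` on `window w m`, with coefficients
generated by `c`. -/
def windowRing (w : Fin 3 → ℤ) (c : Fin 3 → K) (m : ℤ) (Y : (Fin 3 → ℤ) → K) : Subring K :=
  Subring.closure (Set.range c ∪ (Y '' window w m ∪ Y⁻¹ '' window w m))

theorem coeff_mem_windowRing (t : Fin 3) : c t ∈ windowRing w c m Y :=
  Subring.subset_closure (.inl ⟨t, rfl⟩)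

theorem init_mem_windowRing {x : Fin 3 → ℤ} (hx : x ∈ window w m) : Y x ∈ windowRing w c m Y :=
  Subring.subset_closure (.inr (.inl ⟨x, hx, rfl⟩))

theorem init_inv_mem_windowRing {x : Fin 3 → ℤ} (hx : x ∈ window w m) :
    (Y x)⁻¹ ∈ windowRing w c m Y :=
  Subring.subset_closure (.inr (.inr ⟨x, hx, rfl⟩))

theorem windowRing_le {R : Subring K} (hc : ∀ t, c t ∈ R)
    (hY : ∀ x ∈ window w m, Y x ∈ R ∧ (Y x)⁻¹ ∈ R) : windowRing w c m Y ≤ R := by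
  rw [windowRing, Subring.closure_le, Set.union_subset_iff, Set.union_subset_iff]
  exact ⟨Set.range_subset_iff.2 hc, Set.image_subset_iff.2 fun x hx => (hY x hx).1,
    Set.image_subset_iff.2 fun x hx => (hY x hx).2⟩

theorem exists_mul_mem_range_of_mem_windowRing {L : Type*} [CommRing L] [Algebra L K]
    {c : Fin 3 → L} {Y : (Fin 3 → ℤ) → L} (hZ : ∀ x ∈ window w m, Z x = algebraMap L K (Y x))
    (D : Submonoid L) (hD : ∀ x ∈ window w m, ∃ d ∈ D, Y x ∣ d) {z : K}
    (hz : z ∈ windowRing w (algebraMap L K ∘ c) m Z) :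
    ∃ d ∈ D, algebraMap L K d * z ∈ (algebraMap L K).range := by
  refine exists_mul_mem_range_of_mem_closure D ?_ hz
  rintro _ (⟨t, rfl⟩ | ⟨x, hx, rfl⟩ | ⟨x, hx, rfl⟩)
  · exact ⟨1, D.one_mem, c t, by simp⟩
  · exact ⟨1, D.one_mem, Y x, by simp [hZ x hx]⟩
  · obtain ⟨_, hd, e, rfl⟩ := hD x hx
    refine ⟨_, hd, ?_⟩
    rw [Pi.inv_apply, hZ x hx, map_mul, mul_right_comm]
    rcases eq_or_ne (algebraMap L K (Y x)) 0 with h | h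
    · simp [h, zero_mem]
    · exact ⟨e, by rw [mul_inv_cancel₀ h, one_mul]⟩

theorem IsGeneric.mem_windowRing {Y : (Fin 3 → ℤ) → LatticeLaurent} (hY : IsGeneric w m T Y)
    (hw : ∀ t, 0 < w t) (hZ : CubeRec w c m T Z)
    (hne : ∀ x, m ≤ w ⬝ᵥ x → w ⬝ᵥ x < T → Z x ≠ 0) {x : Fin 3 → ℤ} (hx : m ≤ w ⬝ᵥ x)
    (hxT : w ⬝ᵥ x ≤ T) : Z x ∈ windowRing w c m Z := by
  by_cases hxw : x ∈ window w m
  · exact init_mem_windowRing hxw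
  have hT : m + ∑ t, w t ≤ T := (not_lt.1 fun h => hxw ⟨hx, h⟩).trans hxT
  have hne' (y) (hy : y ∈ window w m) : Z y ≠ 0 := hne y hy.1 (hy.2.trans_le hT)
  classical
  let f (y : Fin 3 → ℤ) : Kˣ := if hy : y ∈ window w m then Units.mk0 (Z y) (hne' y hy) else 1
  have hf {y} (hy : y ∈ window w m) : (f y : K) = Z y := by simp [f, hy]
  have hf' {y} (hy : y ∉ window w m) : f y = 1 := dif_neg hy
  have lift_Y : CubeRec w c m T (lift c f ∘ Y) := by
    have := hY.cubeRec.map (lift c f)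
    rwa [show lift c f ∘ param = c from funext (lift_param c f)] at this
  have specialize : Z x = lift c f (Y x) := hZ.ext hw lift_Y hne
    (fun y hy _ => by rw [Function.comp_apply, hY.eq_var y hy, lift_var, hf hy]) x hx hxT
  rw [specialize]
  refine lift_mem _ coeff_mem_windowRing (fun y => ?_) (fun y => ?_) _ <;>
    by_cases hy : y ∈ window w m
  · rw [hf hy]; exact init_mem_windowRing hy
  · rw [hf' hy]; exact one_mem _
  · rw [hf hy]; exact init_inv_mem_windowRing hy
  · rw [hf' hy, Units.val_one, inv_one]; exact one_mem _

end WindowRing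

namespace IsGeneric

variable {w : Fin 3 → ℤ} {m T : ℤ} {Y : (Fin 3 → ℤ) → LatticeLaurent} {x : Fin 3 → ℤ}

theorem ne_zero (hY : IsGeneric w m T Y) (hw : ∀ t, 0 < w t) (hx : m ≤ w ⬝ᵥ x)
    (hxT : w ⬝ᵥ x ≤ T) : Y x ≠ 0 := fun h => by
  let ε : LatticeLaurent →+* ℚ := lift 1 1
  have pos : 0 < ε (Y x) := (hY.cubeRec.map ε).pos hw (fun t => by simp [ε])
    (fun y hy _ => by simp [ε, hY.eq_var y hy]) x hx hxT
  rw [h, map_zero] at pos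
  exact pos.false

theorem mem_range_of_mem_windowRing (hY : IsGeneric w m T Y) (hw : ∀ t, 0 < w t)
    (hT : m + ∑ t, w t + ∑ t, w t ≤ T) {K : Type*} [Field K] [Algebra LatticeLaurent K]
    [FaithfulSMul LatticeLaurent K] {Z : (Fin 3 → ℤ) → K}
    (hZ : ∀ x, m ≤ w ⬝ᵥ x → w ⬝ᵥ x ≤ T → Z x = algebraMap LatticeLaurent K (Y x)) {z : K}
    (hz : z ∈ windowRing w (algebraMap LatticeLaurent K ∘ param) (m + 1) Z)
    (hz' : z ∈ windowRing w (algebraMap LatticeLaurent K ∘ param) (m + ∑ t, w t + 1) Z) :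
    z ∈ (algebraMap LatticeLaurent K).range := by
  have hN : 0 < ∑ t, w t := (hw 0).trans (weight_lt_sum hw 0)
  let P : Set LatticeLaurent := (fun v => Y (v + 1)) '' {v | w ⬝ᵥ v = m}
  let E : Set LatticeLaurent := Y '' window w (m + ∑ t, w t + 1)
  have hZ' (m') (h : m < m') (h' : m' ≤ m + ∑ t, w t + 1) (x) (hx : x ∈ window w m') :
      Z x = algebraMap LatticeLaurent K (Y x) :=
    hZ x (by linarith [hx.1]) (by linarith [hx.2])
  obtain ⟨e, he, hez⟩ := exists_mul_mem_range_of_mem_windowRing (hZ' _ (by linarith) le_rfl)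
    (Submonoid.closure E) (fun x hx => ⟨Y x, Submonoid.subset_closure ⟨x, hx, rfl⟩, dvd_rfl⟩) hz'
  have hP (x) (hx : x ∈ window w (m + 1)) : ∃ d ∈ Submonoid.closure P, Y x ∣ d := by
    rcases lt_or_ge (w ⬝ᵥ x) (m + ∑ t, w t) with h | h
    · rw [hY.eq_var x ⟨by linarith [hx.1], h⟩]
      exact ⟨1, one_mem _, (var x).isUnit.dvd⟩
    · refine ⟨Y x, Submonoid.subset_closure ⟨x - 1, ?_, by simp⟩, dvd_rfl⟩
      rw [Set.mem_ofPred_eq, level_sub_one]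
      linarith [hx.2]
  obtain ⟨d, hd, hdz⟩ := exists_mul_mem_range_of_mem_windowRing
    (hZ' _ (by linarith) (by linarith)) (Submonoid.closure P) hP hz
  refine mem_range_of_coprime_denominators ?_ ?_ hd he hdz hez
  · rintro _ ⟨v, hv, rfl⟩
    exact hY.prime hw hv (by linarith)
  · rintro _ ⟨v, hv, rfl⟩ _ ⟨y, ⟨hy, hy'⟩, rfl⟩
    exact hY.not_dvd hw hv (by linarith) (by linarith) (by linarith)

theorem dvd_sum_of_le (hY : IsGeneric w m (T - 1) Y) (hw : ∀ t, 0 < w t) (hx : m ≤ w ⬝ᵥ x)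
    (hxm : w ⬝ᵥ x ≤ m + ∑ t, w t) (hxT : w ⬝ᵥ (x + 1) = T) :
    Y x ∣ ∑ t, param t * Y (x + 𝐞[t]) * Y (x + 1 - 𝐞[t]) := by
  rcases hxm.lt_or_eq with h | h
  · rw [hY.eq_var x ⟨hx, h⟩]
    exact (var x).isUnit.dvd
  obtain ⟨u, rfl⟩ : ∃ u, x = u + 1 := ⟨x - 1, by simp⟩
  have hu : w ⬝ᵥ u = m := by rw [level_add_one] at h; linarith
  have hunit : IsUnit (∏ t, Y (u + 1 - 𝐞[t])) := by
    refine IsUnit.prod_univ_iff.2 fun t => ?_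
    rw [hY.eq_var]
    · exact (var _).isUnit
    · constructor <;> simp only [level_sub_single, level_add_one, hu] <;>
        linarith [hw t, weight_lt_sum hw t]
  rw [← hunit.dvd_mul_left, hY.cubeRec.prod_mul_sum_eq hw hu.ge (by linarith)]
  exact dvd_mul_right _ _

theorem dvd_sum (hY : IsGeneric w m (T - 1) Y) (hw : ∀ t, 0 < w t)
    (ih : ∀ m', m < m' → ∃ Y, IsGeneric w m' T Y) (hx : m ≤ w ⬝ᵥ x) (hxT : w ⬝ᵥ (x + 1) = T) :
    Y x ∣ ∑ t, param t * Y (x + 𝐞[t]) * Y (x + 1 - 𝐞[t]) := by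
  rcases le_or_gt (w ⬝ᵥ x) (m + ∑ t, w t) with h | h
  · exact hY.dvd_sum_of_le hw hx h hxT
  have hlt := weight_lt_sum hw
  have hN : 0 < ∑ t, w t := (hw 0).trans (hlt 0)
  let K := FractionRing LatticeLaurent
  let ι : LatticeLaurent →+* K := algebraMap LatticeLaurent K
  have hι : Function.Injective ι := FaithfulSMul.algebraMap_injective _ _
  have hne (y) (hy : m ≤ w ⬝ᵥ y) (hyT : w ⬝ᵥ y < T) : ι (Y y) ≠ 0 :=
    (map_ne_zero_iff ι hι).2 (hY.ne_zero hw hy (by linarith))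
  obtain ⟨Z, hZ, hZY⟩ := (hY.cubeRec.map ι).exists_extension hw (T := T) fun y hy hyT =>
    (IsUnit.mk0 _ (hne y hy (by rw [level_add_one] at hyT; linarith))).dvd
  have mem (m') (hm' : m < m') (hm'T : m' ≤ T) : Z (x + 1) ∈ windowRing w (ι ∘ param) m' Z := by
    obtain ⟨X, hX⟩ := ih m' hm'
    refine hX.mem_windowRing hw (hZ.mono hm'.le le_rfl) (fun y hy hyT => ?_) (hxT ▸ hm'T) hxT.le
    exact hZY y hyT ▸ hne y (hm'.le.trans hy) hyT
  have hrec := hZ x hx hxT.le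
  rw [level_add_one] at hxT
  obtain ⟨s, hs⟩ := hY.mem_range_of_mem_windowRing hw (by linarith)
    (fun y _ hy => hZY y (by linarith)) (mem (m + 1) (by linarith) (by linarith))
    (mem (m + ∑ t, w t + 1) (by linarith) (by linarith))
  refine ⟨s, hι ?_⟩
  rw [map_mul, mul_comm, show ι s = _ from hs, ← Function.comp_apply (f := ι) (g := Y),
    ← hZY x (by linarith), hrec, map_sum]
  refine sum_congr rfl fun t _ => ?_
  rw [hZY, hZY] <;> simp only [level_add_single, level_sub_single, level_add_one, map_mul,
    Function.comp_apply] <;> linarith [hw t, hlt t]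

end IsGeneric

theorem exists_isGeneric {w : Fin 3 → ℤ} (hw : ∀ t, 0 < w t) (m T : ℤ) :
    ∃ Y, IsGeneric w m T Y := by
  induction hN : (T - m).toNat using Nat.strong_induction_on generalizing m T with
  | _ N ih =>
  rcases lt_or_ge T (m + ∑ t, w t) with hT | hT
  · refine ⟨fun x => var x, fun x hx hxT => ?_, fun x _ => rfl⟩
    rw [level_add_one] at hxT
    linarith
  have hsum : 0 < ∑ t, w t := (hw 0).trans (weight_lt_sum hw 0)
  obtain ⟨Y, hY⟩ := ih _ (by lia) m (T - 1) rfl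
  have ih' (m') (hm' : m < m') : ∃ Y, IsGeneric w m' T Y := ih _ (by lia) m' T rfl
  obtain ⟨Z, hZ, hZY⟩ := hY.cubeRec.exists_extension hw fun x hx hxT => hY.dvd_sum hw ih' hx hxT
  exact ⟨Z, hZ, fun x hx => by rw [hZY x (by linarith [hx.2]), hY.eq_var x hx]⟩

theorem CubeRec.mem_windowRing {w : Fin 3 → ℤ} {m T : ℤ} (hw : ∀ t, 0 < w t) {K : Type*} [Field K]
    {c : Fin 3 → K} {Y : (Fin 3 → ℤ) → K} (hY : CubeRec w c m T Y)
    (hne : ∀ x, m ≤ w ⬝ᵥ x → w ⬝ᵥ x < T → Y x ≠ 0) {x : Fin 3 → ℤ} (hx : m ≤ w ⬝ᵥ x)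
    (hxT : w ⬝ᵥ x ≤ T) : Y x ∈ windowRing w c m Y := by
  obtain ⟨G, hG⟩ := exists_isGeneric hw m T
  exact hG.mem_windowRing hw hY hne hx hxT

/-! ### Gale-Robinson sequences -/

section GaleRobinson

variable {p q r : ℕ} {F : Type*} [Field F] {α β γ : F} {y z : ℕ → F}

theorem galeRobinson_induction (hp : 0 < p) (hq : 0 < q) (hr : 0 < r) {C : ℕ → Prop}
    (init : ∀ k < p + q + r, C k)
    (step : ∀ k, C k → C (k + p) → C (k + (p + q + r) - p) → C (k + q) →
      C (k + (p + q + r) - q) → C (k + r) → C (k + (p + q + r) - r) → C (k + (p + q + r)))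
    (k : ℕ) : C k := by
  induction k using Nat.strong_induction_on with
  | _ k ih =>
    rcases lt_or_ge k (p + q + r) with h | h
    · exact init k h
    · obtain ⟨k, rfl⟩ := Nat.exists_eq_add_of_le' h
      apply step <;> apply ih <;> lia

/-- The Gale-Robinson sequence with initial values `f`. -/
noncomputable def galeRobinson (hp : 0 < p) (hq : 0 < q) (hr : 0 < r) (α β γ : F) (f : ℕ → F)
    (k : ℕ) : F :=
  if k < p + q + r then f k else
    (α * galeRobinson hp hq hr α β γ f (k - (p + q + r) + p)
        * galeRobinson hp hq hr α β γ f (k - p)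
      + β * galeRobinson hp hq hr α β γ f (k - (p + q + r) + q)
        * galeRobinson hp hq hr α β γ f (k - q)
      + γ * galeRobinson hp hq hr α β γ f (k - (p + q + r) + r)
        * galeRobinson hp hq hr α β γ f (k - r))
      / galeRobinson hp hq hr α β γ f (k - (p + q + r))
termination_by k

theorem galeRobinson_of_lt (hp : 0 < p) (hq : 0 < q) (hr : 0 < r) (α β γ : F) (f : ℕ → F) {k : ℕ}
    (hk : k < p + q + r) : galeRobinson hp hq hr α β γ f k = f k := by
  rw [galeRobinson, if_pos hk]

theorem isGaleRobinson_galeRobinson (hp : 0 < p) (hq : 0 < q) (hr : 0 < r) (α β γ : F)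
    (f : ℕ → F) : IsGaleRobinson p q r α β γ (galeRobinson hp hq hr α β γ f) := by
  intro k
  rw [galeRobinson, if_neg (by lia)]
  simp only [add_tsub_cancel_right]

namespace IsGaleRobinson

theorem ext (hp : 0 < p) (hq : 0 < q) (hr : 0 < r) (hy : IsGaleRobinson p q r α β γ y)
    (hz : IsGaleRobinson p q r α β γ z) (init : ∀ k < p + q + r, y k = z k) : y = z := by
  funext k
  refine galeRobinson_induction (C := fun k => y k = z k) hp hq hr init ?_ k
  intro k h₀ h₁ h₂ h₃ h₄ h₅ h₆
  rw [hy, hz, h₀, h₁, h₂, h₃, h₄, h₅, h₆]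

theorem forall_of_closed (hp : 0 < p) (hq : 0 < q) (hr : 0 < r)
    (hy : IsGaleRobinson p q r α β γ y) {C : F → Prop}
    (hadd : ∀ x y, C x → C y → C (x + y)) (hmul : ∀ x y, C x → C y → C (x * y))
    (hdiv : ∀ x y, C x → C y → C (x / y)) (hα : C α) (hβ : C β) (hγ : C γ)
    (init : ∀ k < p + q + r, C (y k)) (k : ℕ) : C (y k) := by
  refine galeRobinson_induction (C := fun k => C (y k)) hp hq hr init ?_ k
  intro k h₀ h₁ h₂ h₃ h₄ h₅ h₆
  rw [hy]
  exact hdiv _ _ (hadd _ _ (hadd _ _ (hmul _ _ (hmul _ _ hα h₁) h₂)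
    (hmul _ _ (hmul _ _ hβ h₃) h₄)) (hmul _ _ (hmul _ _ hγ h₅) h₆)) h₀

theorem cubeRec (hy : IsGaleRobinson p q r α β γ y) (hne : ∀ k, y k ≠ 0) (M : ℕ) (T : ℤ) :
    CubeRec ![(p : ℤ), q, r] ![α, β, γ] (-M) T
      fun x => y (M + ![(p : ℤ), q, r] ⬝ᵥ x).toNat := by
  intro x hx _
  obtain ⟨s, hs⟩ := Int.eq_ofNat_of_zero_le (a := M + ![(p : ℤ), q, r] ⬝ᵥ x) (by linarith)
  have hx : y (M + ![(p : ℤ), q, r] ⬝ᵥ x).toNat = y s := by rw [hs, Int.toNat_natCast]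
  have hx' : y (M + ![(p : ℤ), q, r] ⬝ᵥ (x + 1)).toNat = y (s + (p + q + r)) := by
    rw [level_add_one, ← add_assoc, hs, Fin.sum_univ_three]
    congr 1
  have low (t : Fin 3) : y (M + ![(p : ℤ), q, r] ⬝ᵥ (x + 𝐞[t])).toNat = y (s + ![p, q, r] t) := by
    rw [level_add_single, ← add_assoc, hs]
    fin_cases t <;> congr 1
  have high (t : Fin 3) : y (M + ![(p : ℤ), q, r] ⬝ᵥ (x + 1 - 𝐞[t])).toNat =
      y (s + (p + q + r) - ![p, q, r] t) := by
    rw [level_sub_single, level_add_one, Fin.sum_univ_three]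
    fin_cases t <;> simp only [Fin.reduceFinMk, Fin.zero_eta, Fin.mk_one, Matrix.cons_val] <;>
      congr 1 <;> lia
  simp only [hx, hx', low, high, Fin.sum_univ_three, Matrix.cons_val]
  rw [hy, div_mul_cancel₀ _ (hne s)]

theorem mem_subring (hp : 0 < p) (hq : 0 < q) (hr : 0 < r) (hy : IsGaleRobinson p q r α β γ y)
    (hne : ∀ k, y k ≠ 0) {R : Subring F} (hα : α ∈ R) (hβ : β ∈ R) (hγ : γ ∈ R)
    (init : ∀ k < p + q + r, y k ∈ R ∧ (y k)⁻¹ ∈ R) (M : ℕ) : y M ∈ R := by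
  have hw (t : Fin 3) : 0 < ![(p : ℤ), q, r] t := by fin_cases t <;> simpa
  have hmem := (hy.cubeRec hne M 0).mem_windowRing hw (fun x _ _ => hne _) (x := 0) (by simp)
    (by simp)
  rw [dotProduct_zero, add_zero, Int.toNat_natCast] at hmem
  refine windowRing_le (fun t => ?_) (fun x ⟨hx, hx'⟩ => init _ ?_) hmem
  · fin_cases t <;> assumption
  · simp only [Fin.sum_univ_three, Matrix.cons_val] at hx'
    lia

theorem integral {a b c : ℤ} {y : ℕ → ℚ} (hp : 0 < p) (hq : 0 < q) (hr : 0 < r)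
    (hy : IsGaleRobinson p q r (a : ℚ) b c y) (ha : 0 < a) (hb : 0 < b) (hc : 0 < c)
    (init : ∀ i < p + q + r, y i = 1) (k : ℕ) : y k ≠ 0 ∧ ∃ z : ℤ, y k = z := by
  have hpos : ∀ k, 0 < y k := hy.forall_of_closed hp hq hr (C := fun x => 0 < x)
    (fun _ _ => add_pos) (fun _ _ => mul_pos) (fun _ _ => div_pos) (mod_cast ha) (mod_cast hb)
    (mod_cast hc) fun k hk => init k hk ▸ one_pos
  obtain ⟨z, hz⟩ := hy.mem_subring hp hq hr (fun k => (hpos k).ne')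
    (R := (Int.castRingHom ℚ).range) ⟨a, rfl⟩ ⟨b, rfl⟩ ⟨c, rfl⟩
    (fun k hk => by rw [init k hk, inv_one]; exact ⟨one_mem _, one_mem _⟩) k
  exact ⟨(hpos k).ne', z, hz.symm⟩

end IsGaleRobinson

end GaleRobinson

/-- `z` is a quotient of two elements of `A` that are positive under `ε`. Unlike the nonzero
elements, these are closed under addition. -/
def IsPosFrac {A K : Type*} [CommRing A] [Field K] [Algebra A K] (ε : A →+* ℚ) (z : K) : Prop :=
  ∃ f g : A, 0 < ε f ∧ 0 < ε g ∧ z = algebraMap A K f / algebraMap A K g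

namespace IsPosFrac

variable {A K : Type*} [CommRing A] [Field K] [Algebra A K] {ε : A →+* ℚ} {x y : K}

theorem of_pos {f : A} (h : 0 < ε f) : IsPosFrac ε (algebraMap A K f) :=
  ⟨f, 1, h, by simp, by simp⟩

theorem mul (hx : IsPosFrac ε x) (hy : IsPosFrac ε y) : IsPosFrac ε (x * y) := by
  obtain ⟨f, g, hf, hg, rfl⟩ := hx
  obtain ⟨f', g', hf', hg', rfl⟩ := hy
  refine ⟨f * f', g * g', ?_, ?_, ?_⟩
  · rw [map_mul]; positivity
  · rw [map_mul]; positivity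
  · rw [map_mul, map_mul, div_mul_div_comm]

theorem inv (hx : IsPosFrac ε x) : IsPosFrac ε x⁻¹ := by
  obtain ⟨f, g, hf, hg, rfl⟩ := hx
  exact ⟨g, f, hg, hf, inv_div _ _⟩

theorem div (hx : IsPosFrac ε x) (hy : IsPosFrac ε y) : IsPosFrac ε (x / y) :=
  div_eq_mul_inv x y ▸ hx.mul hy.inv

variable [FaithfulSMul A K]

theorem algebraMap_ne_zero_of_pos {g : A} (hg : 0 < ε g) : algebraMap A K g ≠ 0 := by
  rw [map_ne_zero_iff _ (FaithfulSMul.algebraMap_injective A K)]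
  rintro rfl
  simp at hg

theorem ne_zero (hx : IsPosFrac ε x) : x ≠ 0 := by
  obtain ⟨f, g, hf, hg, rfl⟩ := hx
  exact div_ne_zero (algebraMap_ne_zero_of_pos hf) (algebraMap_ne_zero_of_pos hg)

theorem add (hx : IsPosFrac ε x) (hy : IsPosFrac ε y) : IsPosFrac ε (x + y) := by
  obtain ⟨f, g, hf, hg, rfl⟩ := hx
  obtain ⟨f', g', hf', hg', rfl⟩ := hy
  refine ⟨f * g' + g * f', g * g', ?_, ?_, ?_⟩
  · rw [map_add, map_mul, map_mul]; positivity
  · rw [map_mul]; positivity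
  · rw [div_add_div _ _ (algebraMap_ne_zero_of_pos hg) (algebraMap_ne_zero_of_pos hg')]
    simp only [map_add, map_mul]

end IsPosFrac

namespace IsGenericGaleRobinson

variable {p q r : ℕ} {y : ℕ → GRField (p + q + r)}

theorem existsUnique (hp : 0 < p) (hq : 0 < q) (hr : 0 < r) :
    ∃! y : ℕ → GRField (p + q + r), IsGenericGaleRobinson p q r y := by
  let f (k : ℕ) : GRField (p + q + r) := if h : k < p + q + r then GRField.var _ ⟨k, h⟩ else 0
  have hf (i : Fin (p + q + r)) : f i = GRField.var _ i := dif_pos i.2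
  refine ⟨galeRobinson hp hq hr (GRField.param _ 0) (GRField.param _ 1) (GRField.param _ 2) f,
    ⟨fun i => ?_, isGaleRobinson_galeRobinson _ _ _ _ _ _ _⟩, fun z hz => ?_⟩
  · rw [galeRobinson_of_lt _ _ _ _ _ _ _ i.2, hf]
  · refine hz.2.ext hp hq hr (isGaleRobinson_galeRobinson _ _ _ _ _ _ _) fun k hk => ?_
    rw [galeRobinson_of_lt _ _ _ _ _ _ _ hk, hf ⟨k, hk⟩, hz.1 ⟨k, hk⟩]

theorem ne_zero (hp : 0 < p) (hq : 0 < q) (hr : 0 < r) (hy : IsGenericGaleRobinson p q r y)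
    (k : ℕ) : y k ≠ 0 := by
  let ε : MvPolynomial (Fin (p + q + r)) GRCoeff →+* ℚ :=
    eval₂Hom (eval₂Hom (Int.castRingHom ℚ) fun _ => 1) fun _ => 1
  have hparam (t : Fin 3) : IsPosFrac ε (GRField.param (p + q + r) t) := by
    rw [GRField.param, IsScalarTower.algebraMap_apply GRCoeff
      (MvPolynomial (Fin (p + q + r)) GRCoeff) (GRField (p + q + r))]
    exact .of_pos (by simp [ε, algebraMap_eq])
  have hinit (k) (hk : k < p + q + r) : IsPosFrac ε (y k) := by
    rw [hy.1 ⟨k, hk⟩]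
    exact .of_pos (by simp [ε])
  exact (hy.2.forall_of_closed hp hq hr (fun _ _ => .add) (fun _ _ => .mul) (fun _ _ => .div)
    (hparam 0) (hparam 1) (hparam 2) hinit k).ne_zero

theorem mem_laurentRing (hp : 0 < p) (hq : 0 < q) (hr : 0 < r)
    (hy : IsGenericGaleRobinson p q r y) (k : ℕ) : y k ∈ laurentRing (p + q + r) := by
  let R := laurentRing (p + q + r)
  have hparam (t : Fin 3) : GRField.param (p + q + r) t ∈ R.toSubring := R.algebraMap_mem _
  have hinit (k) (hk : k < p + q + r) : y k ∈ R.toSubring ∧ (y k)⁻¹ ∈ R.toSubring := by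
    rw [hy.1 ⟨k, hk⟩]
    exact ⟨Algebra.subset_adjoin (.inl ⟨_, rfl⟩), Algebra.subset_adjoin (.inr ⟨_, rfl⟩)⟩
  exact hy.2.mem_subring hp hq hr (hy.ne_zero hp hq hr) (hparam 0) (hparam 1) (hparam 2) hinit k

end IsGenericGaleRobinson

theorem somos_six_integral {y : ℕ → ℚ} (init : ∀ i < 6, y i = 1)
    (hy : ∀ k, y (k + 6) =
      (y (k + 1) * y (k + 5) + y (k + 2) * y (k + 4) + y (k + 3) ^ 2) / y k) (k : ℕ) :
    y k ≠ 0 ∧ ∃ z : ℤ, y k = z := by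
  have hy' : IsGaleRobinson 1 2 3 ((1 : ℤ) : ℚ) (1 : ℤ) (1 : ℤ) y := fun k => by
    have e : k + 6 - 3 = k + 3 := rfl
    simpa [e, sq] using hy k
  exact hy'.integral one_pos two_pos three_pos one_pos one_pos one_pos init k

theorem somos_seven_integral {y : ℕ → ℚ} (init : ∀ i < 7, y i = 1)
    (hy : ∀ k, y (k + 7) =
      (y (k + 1) * y (k + 6) + y (k + 2) * y (k + 5) + y (k + 3) * y (k + 4)) / y k) (k : ℕ) :
    y k ≠ 0 ∧ ∃ z : ℤ, y k = z := by
  have hy' : IsGaleRobinson 1 2 4 ((1 : ℤ) : ℚ) (1 : ℤ) (1 : ℤ) y := fun k => by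
    have e : k + 7 - 4 = k + 3 := rfl
    simpa [e, mul_comm (y (k + 3))] using hy k
  exact hy'.integral one_pos two_pos four_pos one_pos one_pos one_pos init k

theorem theorem1p2_general {p q r : ℕ} (hp : 0 < p) (hq : 0 < q) (hr : 0 < r) :
    (∃! y : ℕ → GRField (p + q + r), IsGenericGaleRobinson p q r y) ∧
    (∀ y : ℕ → GRField (p + q + r), IsGenericGaleRobinson p q r y →
      ∀ m : ℕ, y m ≠ 0 ∧ y m ∈ laurentRing (p + q + r)) ∧
    (∀ (a b c : ℤ), 0 < a → 0 < b → 0 < c → ∀ y : ℕ → ℚ,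
      (∀ i < p + q + r, y i = 1) → IsGaleRobinson p q r (a : ℚ) (b : ℚ) (c : ℚ) y →
      ∀ m : ℕ, y m ≠ 0 ∧ ∃ z : ℤ, y m = (z : ℚ)) :=
  ⟨IsGenericGaleRobinson.existsUnique hp hq hr,
    fun _ hy m => ⟨hy.ne_zero hp hq hr m, hy.mem_laurentRing hp hq hr m⟩,
    fun _ _ _ ha hb hc _ init hy => hy.integral hp hq hr ha hb hc init⟩

theorem theorem1p2 :
    (∀ p q r : ℕ, 0 < p → 0 < q → 0 < r → p ≠ q → p ≠ r → q ≠ r →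
      -- The generic sequence is well defined, never divides by zero, and is Laurent.
      (∃! y : ℕ → GRField (p + q + r), IsGenericGaleRobinson p q r y) ∧
      (∀ y : ℕ → GRField (p + q + r), IsGenericGaleRobinson p q r y →
        ∀ m : ℕ, y m ≠ 0 ∧ y m ∈ laurentRing (p + q + r)) ∧
      -- The integrality conjecture.
      (∀ (a b c : ℤ), 0 < a → 0 < b → 0 < c → ∀ y : ℕ → ℚ,
        (∀ i < p + q + r, y i = 1) → IsGaleRobinson p q r (a : ℚ) (b : ℚ) (c : ℚ) y →
        ∀ m : ℕ, y m ≠ 0 ∧ ∃ z : ℤ, y m = (z : ℚ))) ∧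
    -- Somos-6.
    (∀ y : ℕ → ℚ, (∀ i < 6, y i = 1) →
      (∀ k : ℕ, y (k + 6) =
        (y (k + 1) * y (k + 5) + y (k + 2) * y (k + 4) + y (k + 3) ^ 2) / y k) →
      ∀ m : ℕ, y m ≠ 0 ∧ ∃ z : ℤ, y m = (z : ℚ)) ∧
    -- Somos-7.
    (∀ y : ℕ → ℚ, (∀ i < 7, y i = 1) →
      (∀ k : ℕ, y (k + 7) =
        (y (k + 1) * y (k + 6) + y (k + 2) * y (k + 5) + y (k + 3) * y (k + 4)) / y k) →
      ∀ m : ℕ, y m ≠ 0 ∧ ∃ z : ℤ, y m = (z : ℚ)) :=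
  ⟨fun _ _ _ hp hq hr _ _ _ => theorem1p2_general hp hq hr,
    fun _ => somos_six_integral, fun _ => somos_seven_integral⟩
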